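/- Let $\gamma=[001,1]$ and $E=[1,0]$ be the morphisms of $\{0,1\}^*$ given by $\gamma(0)=001$, $\gamma(1)=1$, $E(0)=1$, $E(1)=0$, and let $S=\{\gamma E, E\gamma\}$. The sequences $$\gamma E\gamma^2E\gamma^3E\cdots\gamma^{n-1}E\gamma^n(0^\omega)\qquad(n\ge 1)$$ converge (in the product topology) as $n\to\infty$ along the odd integers and as $n\to\infty$ along the even integers. Let $\mathbf w$ be either of these two limits (the two versions of the sequence $\mathbf w_{\gamma,E}$). Then 1. $\mathbf w$ is $S$-adic: there are morphisms $\sigma_0,\sigma_1,\ldots\in S$ and letters $a_0,a_1,\ldots\in\{0,1\}$ such that $\mathbf w=\lim_{n\to\infty}\sigma_0\sigma_1\cdots\sigma_n(a_{n+1}^\omega)$ and $|\sigma_0\sigma_1\cdots\sigma_n(a_{n+1})|\to\infty$; 2. $\mathbf w$ is uniformly recurrent: every factor of $\mathbf w$ occurs in $\mathbf w$ infinitely often and with bounded gaps; 3. $\mathbf w$ does not have a sub-linear complexity: if $p_{\mathbf w}(n)$ denotes the number of factors of length $n$ of $\mathbf w$, then $p_{\mathbf w}(n)\notin O(n)$.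 On the other hand, for each $\sigma\in S$ and each $k\ge1$, every sequence $\mathbf x\in\{0,1\}^{\mathbb N}$ with $\sigma^k(\mathbf x)=\mathbf x$ satisfies $p_{\mathbf x}(n)\in O(n)$. Hence it is not true that, whenever a set $S$ contains only morphisms for which all fixed points of all powers have sub-linear complexity, every $S$-adic sequence has sub-linear complexity. -/

import Mathlib

open Filter Topology Asymptotics

/-- Morphisms `A* → A*` of the free monoid `A*` of finite words over `A`. In this monoid the
product `σ * τ` is the composition `σ ∘ τ`. -/
abbrev WordMorphism (A : Type*) : Type _ := Monoid.End (FreeMonoid A)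

/-- The image `σ(x)` of a sequence `x = x₀x₁x₂…`, i.e. the infinite concatenation
`σ(x₀)σ(x₁)σ(x₂)…`, for a morphism `σ` that erases no letter of `x`: then the word
`σ(x₀x₁…xₙ)` has at least `n + 1` letters, and its letter of index `n` is the letter of index `n`
of `σ(x)`. (The fallback letter `x n` is never used in that case.) -/
def WordMorphism.onSeq {A : Type*} (σ : WordMorphism A) (x : ℕ → A) (n : ℕ) : A :=
  (FreeMonoid.toList (σ (FreeMonoid.ofList ((List.range (n + 1)).map x)))).getD n (x n)

/-- The composition `σ₀σ₁⋯σₙ₋₁` of the first `n` terms of a sequence of morphisms. -/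
def prefixComp {A : Type*} (σ : ℕ → WordMorphism A) : ℕ → WordMorphism A
  | 0 => 1
  | n + 1 => prefixComp σ n * σ n

/-- `w` is `S`-adic: there are a directive word `(σₙ)` in `S` and letters `(aₙ)` with
`w = lim σ₀σ₁⋯σₙ(aₙ₊₁^ω)` (product topology of the discrete topology on `A`) and
`|σ₀σ₁⋯σₙ(aₙ₊₁)| → ∞`. (The second condition makes `σ₀σ₁⋯σₙ(aₙ₊₁)` non-empty for large `n`, so
that `σ₀σ₁⋯σₙ(aₙ₊₁^ω)` is indeed a sequence.) -/
def IsSAdic {A : Type*} [TopologicalSpace A] [DiscreteTopology A]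
    (S : Set (WordMorphism A)) (w : ℕ → A) : Prop :=
  ∃ (σ : ℕ → WordMorphism A) (a : ℕ → A),
    (∀ n, σ n ∈ S) ∧
    Tendsto (fun n => (prefixComp σ (n + 1)).onSeq (fun _ => a (n + 1))) atTop (𝓝 w) ∧
    Tendsto (fun n => (prefixComp σ (n + 1) (FreeMonoid.of (a (n + 1)))).length) atTop atTop

/-- The set of factors of length `n` of the sequence `w`. -/
def factorsOfLength {A : Type*} (w : ℕ → A) (n : ℕ) : Set (Fin n → A) :=
  {u | ∃ i : ℕ, ∀ j : Fin n, u j = w (i + j)}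

/-- The factor complexity `p_w(n)`: the number of factors of length `n` of `w`. -/
noncomputable def factorComplexity {A : Type*} (w : ℕ → A) (n : ℕ) : ℕ :=
  (factorsOfLength w n).ncard

/-- Sub-linear complexity in the sense `p_w(n) ∈ O(n)`. -/
def HasSubLinearComplexity {A : Type*} (w : ℕ → A) : Prop :=
  (fun n : ℕ => (factorComplexity w n : ℝ)) =O[atTop] (fun n : ℕ => (n : ℝ))

/-- Uniform recurrence: every factor of `w` occurs infinitely often and with bounded gaps, i.e.
some `g` is such that every window of `g + 1` consecutive positions contains the starting
position of an occurrence. -/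
def IsUniformlyRecurrent {A : Type*} (w : ℕ → A) : Prop :=
  ∀ (n : ℕ), ∀ u ∈ factorsOfLength w n,
    ∃ g : ℕ, ∀ m : ℕ, ∃ i : ℕ, m ≤ i ∧ i ≤ m + g ∧ ∀ j : Fin n, u j = w (i + j)

/-- The morphism `γ = [001, 1]` on `{0, 1}*`. -/
def morphGamma : WordMorphism (Fin 2) :=
  FreeMonoid.lift ![FreeMonoid.ofList [0, 0, 1], FreeMonoid.ofList [1]]

/-- The morphism `E = [1, 0]` on `{0, 1}*`. -/
def morphE : WordMorphism (Fin 2) :=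
  FreeMonoid.lift ![FreeMonoid.ofList [1], FreeMonoid.ofList [0]]

/-- `gammaEComp n` is the composition `γ E γ² E γ³ E ⋯ γⁿ E γⁿ⁺¹`. -/
def gammaEComp : ℕ → WordMorphism (Fin 2)
  | 0 => morphGamma
  | n + 1 => gammaEComp n * morphE * morphGamma ^ (n + 2)

/-! Write `G n` for `gammaEComp n` and `ℓ` for the length of `G n (0)`. Since `γ` fixes `1` and
`E(1) = 0`, `G (n+1) (1) = G n (0)`; and since `γᵏ(0)` begins with `00` for `k ≥ 1`, `G (n+2) (0)`
begins with `G n (00)`. So the words `G n (0)` with `n` of a fixed parity form a chain of prefixes,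
which defines the limit. Uniform recurrence holds because `G n (0)` occurs in the images of both
letters under `G (n+1)`.

Complexity: put `φ = G n * E`, so that `φ(1)` has length `ℓ`. For `k < n + 2` the word `γᵏ(0)` is
followed by both letters inside `γⁿ⁺²(0)`, and `φ(0)`, `φ(1)` begin with different letters, so all
suffixes of `φ(γᵏ(0))` are right special. As `γᵏ(0)` ends with `01ᵏ`, the suffixes of a length `N ≥
(n+3)ℓ` differ for different `k`: `φ` adds at most `ℓ` letters to the common suffix `φ(1ᵏ)`. They
exist once `2ᵏ ℓ ≥ N + ℓ`. With `K` about `n/2` this gives at least `K` right special words for each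
`N` between `M = (n+3)ℓ` and `2M`, hence `p(2M) ≥ K M` (`factorComplexity_add_le`,
`not_hasSubLinearComplexity`).

The directive word exists because `γγ = (γE)(Eγ)`: an `E` can be inserted after a `γ` and cancelled
at the next step (`prefixComp_directive`). For a fixed point, both morphisms in `S` double a
positive weight on words, so the images of the two letters under the `m`-th power have lengths
comparable to `2ᵐ`, which forces linear complexity. -/

/-! ### Morphisms acting on words, seen as lists -/

section General

variable {A : Type*}

/-- The image of a word, given as a list of letters. -/
def WordMorphism.onList (σ : WordMorphism A) (l : List A) : List A :=
  FreeMonoid.toList (σ (FreeMonoid.ofList l))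

namespace WordMorphism

@[simp] theorem onList_nil (σ : WordMorphism A) : σ.onList [] = [] := by
  simp [onList]

@[simp] theorem onList_append (σ : WordMorphism A) (l m : List A) :
    σ.onList (l ++ m) = σ.onList l ++ σ.onList m := by
  simp [onList]

theorem onList_cons (σ : WordMorphism A) (a : A) (l : List A) :
    σ.onList (a :: l) = σ.onList [a] ++ σ.onList l := by
  rw [← onList_append]; rfl

theorem onList_mul (σ τ : WordMorphism A) (l : List A) :
    (σ * τ).onList l = σ.onList (τ.onList l) := rfl

@[simp] theorem onList_one (l : List A) : (1 : WordMorphism A).onList l = l := rfl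

theorem onList_prefix (σ : WordMorphism A) {l m : List A} (h : l <+: m) :
    σ.onList l <+: σ.onList m := by
  obtain ⟨t, rfl⟩ := h
  simp

theorem ext_onList {σ τ : WordMorphism A} (h : ∀ a, σ.onList [a] = τ.onList [a]) : σ = τ := by
  refine FreeMonoid.hom_eq fun a => ?_
  exact FreeMonoid.toList.injective (h a)

/-- No letter is erased. -/
def NonErasing (σ : WordMorphism A) : Prop := ∀ a, σ.onList [a] ≠ []

theorem NonErasing.length_le {σ : WordMorphism A} (h : σ.NonErasing) (l : List A) :
    l.length ≤ (σ.onList l).length := by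
  induction l with
  | nil => simp
  | cons a l ih =>
    rw [onList_cons, List.length_append, List.length_cons]
    have := List.length_pos_iff.2 (h a)
    omega

theorem NonErasing.mul {σ τ : WordMorphism A} (hσ : σ.NonErasing) (hτ : τ.NonErasing) :
    (σ * τ).NonErasing := by
  intro a
  rw [onList_mul, ← List.length_pos_iff]
  exact (List.length_pos_iff.2 (hτ a)).trans_le (hσ.length_le _)

theorem NonErasing.one : (1 : WordMorphism A).NonErasing := by
  intro a; simp

theorem NonErasing.pow {σ : WordMorphism A} (hσ : σ.NonErasing) (n : ℕ) :
    (σ ^ n).NonErasing := by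
  induction n with
  | zero => simpa using NonErasing.one
  | succ n ih => rw [pow_succ]; exact ih.mul hσ

/-- The letter of index `i` of `σ(v)` lies in the image of some letter of `v`. -/
theorem exists_cut (σ : WordMorphism A) (v : List A) (i : ℕ) (hi : i < (σ.onList v).length) :
    ∃ v₁ a v₂, v = v₁ ++ a :: v₂ ∧ (σ.onList v₁).length ≤ i ∧
      i < (σ.onList v₁).length + (σ.onList [a]).length := by
  induction v generalizing i with
  | nil => simp at hi
  | cons a v ih =>
    rw [onList_cons, List.length_append] at hi
    by_cases h : i < (σ.onList [a]).length
    · exact ⟨[], a, v, rfl, by simp, by simpa using h⟩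
    · obtain ⟨v₁, b, v₂, rfl, h1, h2⟩ := ih (i - (σ.onList [a]).length) (by omega)
      refine ⟨a :: v₁, b, v₂, rfl, ?_, ?_⟩ <;> rw [onList_cons, List.length_append] <;> omega

end WordMorphism

/-! ### Occurrences of words in sequences -/

/-- The word `l` occurs in the sequence `w` at position `i`. -/
def OccursAt (l : List A) (w : ℕ → A) (i : ℕ) : Prop :=
  ∀ j (h : j < l.length), l[j] = w (i + j)

theorem OccursAt.of_append {l₁ l₂ l₃ : List A} {w : ℕ → A} {i : ℕ}
    (h : OccursAt (l₁ ++ l₂ ++ l₃) w i) : OccursAt l₂ w (i + l₁.length) := by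
  intro j hj
  have := h (l₁.length + j) (by simp; omega)
  rw [List.getElem_append_left (by simpa using hj), List.getElem_append_right (by omega)] at this
  simp only [Nat.add_sub_cancel_left] at this
  rw [this, add_assoc]

theorem OccursAt.of_prefix {l m : List A} {w : ℕ → A} {i : ℕ}
    (h : OccursAt m w i) (hl : l <+: m) : OccursAt l w i := by
  obtain ⟨t, rfl⟩ := hl
  simpa using OccursAt.of_append (l₁ := []) (by simpa using h)

theorem occursAt_map_range (w : ℕ → A) (n : ℕ) : OccursAt ((List.range n).map w) w 0 := by
  intro j hj; simp

theorem OccursAt.prefix_of_le {l m : List A} {w : ℕ → A} {i : ℕ} (hl : OccursAt l w i)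
    (hm : OccursAt m w i) (h : l.length ≤ m.length) : l <+: m := by
  rw [List.prefix_iff_getElem]
  exact ⟨h, fun j hj => by rw [hl j hj, hm j (hj.trans_le h)]⟩

/-- Both `l` and the first `n + 1` letters of `x` are prefixes of `x`, so one is a prefix of the
other, and so are their images. Non-erasure keeps the fallback letter of `onSeq` out of play. -/
theorem WordMorphism.NonErasing.occursAt_onSeq {σ : WordMorphism A} (hσ : σ.NonErasing)
    {l : List A} {x : ℕ → A} (hl : OccursAt l x 0) : OccursAt (σ.onList l) (σ.onSeq x) 0 := by
  intro n hn
  have hp := occursAt_map_range x (n + 1)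
  have hlen : n < (σ.onList ((List.range (n + 1)).map x)).length :=
    lt_of_lt_of_le (by simp) (hσ.length_le _)
  have key : σ.onSeq x (0 + n) = (σ.onList ((List.range (n + 1)).map x))[n] := by
    rw [zero_add]
    exact List.getD_eq_getElem _ _ hlen
  rw [key]
  rcases le_total l.length ((List.range (n + 1)).map x).length with h | h
  · exact (σ.onList_prefix (hl.prefix_of_le hp h)).getElem hn
  · exact ((σ.onList_prefix (hp.prefix_of_le hl h)).getElem hlen).symm

/-- Sequences sharing longer and longer prefixes with `w` converge to `w`. -/
theorem tendsto_of_occursAt [TopologicalSpace A] {f : ℕ → ℕ → A} {l : ℕ → List A} {w : ℕ → A}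
    (hf : ∀ n, OccursAt (l n) (f n) 0) (hw : ∀ n, OccursAt (l n) w 0)
    (hl : Tendsto (fun n => (l n).length) atTop atTop) : Tendsto f atTop (𝓝 w) := by
  rw [tendsto_pi_nhds]
  intro i
  refine tendsto_const_nhds.congr' ?_
  filter_upwards [hl.eventually_gt_atTop i] with n hn
  have h1 := hf n i hn
  have h2 := hw n i hn
  rw [zero_add] at h1 h2
  rw [← h1, ← h2]

/-- A chain of prefixes of growing lengths defines a sequence. -/
theorem exists_seq_of_prefix_chain (l : ℕ → List A) (hl : ∀ n, l n <+: l (n + 1))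
    (hlen : ∀ n, n < (l n).length) : ∃ w : ℕ → A, ∀ n, OccursAt (l n) w 0 := by
  have mono : ∀ m n, m ≤ n → l m <+: l n := by
    intro m n h
    induction n, h using Nat.le_induction with
    | base => exact List.prefix_rfl
    | succ n _ ih => exact ih.trans (hl n)
  refine ⟨fun i => (l i)[i]'(hlen i), fun n i hi => ?_⟩
  simp only [zero_add]
  rcases le_total n i with h | h
  · exact (mono _ _ h).getElem hi
  · exact ((mono _ _ h).getElem (hlen i)).symm

/-! ### Counting factors and bounding gaps -/

/-- The words of length `n` occurring in `w`. -/
def wordsOfLength (w : ℕ → A) (n : ℕ) : Set (List A) :=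
  {l | l.length = n ∧ ∃ i, OccursAt l w i}

theorem ofFn_mem_wordsOfLength {w : ℕ → A} {n : ℕ} {u : Fin n → A}
    (hu : u ∈ factorsOfLength w n) : List.ofFn u ∈ wordsOfLength w n := by
  obtain ⟨i, hi⟩ := hu
  exact ⟨by simp, i, fun j hj => by simpa using hi ⟨j, by simpa using hj⟩⟩

theorem factorComplexity_eq (w : ℕ → A) (n : ℕ) :
    factorComplexity w n = (wordsOfLength w n).ncard := by
  refine Set.ncard_congr (fun u _ => List.ofFn u) (fun u hu => ofFn_mem_wordsOfLength hu)
    (fun u v _ _ h => List.ofFn_injective h) ?_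
  rintro l ⟨rfl, i, hi⟩
  exact ⟨l.get, ⟨i, fun j => by simpa using hi j j.2⟩, by simp⟩

theorem finite_wordsOfLength [Finite A] (w : ℕ → A) (n : ℕ) : (wordsOfLength w n).Finite :=
  (List.finite_length_eq A n).subset fun _ h => h.1

/-- If the images `τ(a)` of letters have lengths between `N` and `L`, and `x` has arbitrarily long
prefixes of the form `τ(v)`, then `p_x(N) ≤ |A|² L`. -/
theorem factorComplexity_le_of_cover [Fintype A] {x : ℕ → A} {τ : WordMorphism A} {N L : ℕ}
    (hN : ∀ a, N ≤ (τ.onList [a]).length) (hL : ∀ a, (τ.onList [a]).length ≤ L)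
    (hx : ∀ n, ∃ v, n ≤ (τ.onList v).length ∧ OccursAt (τ.onList v) x 0) :
    factorComplexity x N ≤ Fintype.card A * Fintype.card A * L := by
  classical
  rw [factorComplexity_eq]
  -- A word of length `N` starting inside `τ(a)` ends at the latest inside the next block `τ(b)`,
  -- because `τ(b)` has at least `N` letters. The pair `(a, b)` and the offset in `τ(a)` determine
  -- it.
  let f : (A × A) × Fin L → List A := fun p =>
    ((τ.onList [p.1.1] ++ τ.onList [p.1.2]).drop p.2).take N
  have hsub : wordsOfLength x N ⊆ Set.range f := by
    rintro l ⟨rfl, i, hi⟩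
    obtain ⟨v, hv, hvx⟩ := hx (i + L + 1)
    obtain ⟨v₁, a, v₂, rfl, h1, h2⟩ := τ.exists_cut v i (by omega)
    have hLa := hL a
    cases v₂ with
    | nil =>
      simp only [WordMorphism.onList_append, List.length_append] at hv
      omega
    | cons b v₃ =>
      have hb := hN b
      refine ⟨((a, b), ⟨i - (τ.onList v₁).length, by omega⟩), ?_⟩
      have hocc : OccursAt (τ.onList [a] ++ τ.onList [b]) x (0 + (τ.onList v₁).length) := by
        refine OccursAt.of_append (l₃ := τ.onList v₃) ?_
        rw [τ.onList_append, τ.onList_cons a, τ.onList_cons b] at hvx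
        simpa using hvx
      refine List.ext_getElem ?_ fun j hj hj' => ?_
      · simp [f]; omega
      · simp only [f, List.getElem_take, List.getElem_drop]
        rw [hi j hj', hocc _ (by simp; omega)]
        congr 1; omega
  calc (wordsOfLength x N).ncard ≤ (Set.range f).ncard :=
        Set.ncard_le_ncard hsub (Set.finite_range f)
    _ ≤ Nat.card ((A × A) × Fin L) := by
        rw [← Set.image_univ, ← Set.ncard_univ]
        exact Set.ncard_image_le
    _ = _ := by simp

/-- If a word occurs in every `σ(a)`, then it occurs with bounded gaps in every sequence with
prefixes `σ(v)` of unbounded lengths. -/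
theorem exists_gap [Finite A] {w : ℕ → A} {σ : WordMorphism A} {u : List A}
    (hu : ∀ a, u <:+: σ.onList [a])
    (hw : ∀ n, ∃ v, n ≤ (σ.onList v).length ∧ OccursAt (σ.onList v) w 0) :
    ∃ g : ℕ, ∀ m, ∃ i, m ≤ i ∧ i ≤ m + g ∧ OccursAt u w i := by
  obtain ⟨L, hL⟩ : ∃ L, ∀ a, (σ.onList [a]).length ≤ L := by
    obtain ⟨L, hL⟩ := (Set.finite_range fun a => (σ.onList [a]).length).bddAbove
    exact ⟨L, fun a => hL ⟨a, rfl⟩⟩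
  refine ⟨2 * L, fun m => ?_⟩
  obtain ⟨v, hv, hvw⟩ := hw (m + L + 1)
  obtain ⟨v₁, a, v₂, rfl, h1, h2⟩ := σ.exists_cut v m (by omega)
  have hLa := hL a
  -- The prefix extends more than `L` letters beyond position `m`, so the block containing `m` is
  -- not the last one; the next block contains `u`.
  cases v₂ with
  | nil =>
    simp only [WordMorphism.onList_append, List.length_append] at hv
    omega
  | cons b v₃ =>
    obtain ⟨s, t, hst⟩ := hu b
    have hLb := hL b
    rw [← hst] at hLb
    simp only [List.length_append] at hLb
    refine ⟨0 + (σ.onList v₁ ++ σ.onList [a] ++ s).length, ?_, ?_,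
      OccursAt.of_append (l₃ := t ++ σ.onList v₃) ?_⟩
    · simp; omega
    · simp; omega
    · rw [σ.onList_append, σ.onList_cons a, σ.onList_cons b, ← hst] at hvw
      simpa using hvw

end General

/-! ### Right special words -/

/-- Each right special word of length `n` contributes to `p_w(n + 1) - p_w(n)`. -/
theorem factorComplexity_add_card_le {w : ℕ → Fin 2} {n : ℕ} (R : Finset (List (Fin 2)))
    (hR : ∀ l ∈ R, l.length = n ∧ ∀ a, ∃ i, OccursAt (l ++ [a]) w i) :
    factorComplexity w n + R.card ≤ factorComplexity w (n + 1) := by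
  classical
  have hext : ∀ l ∈ wordsOfLength w n, ∃ a, l ++ [a] ∈ wordsOfLength w (n + 1) := by
    rintro l ⟨rfl, i, hi⟩
    refine ⟨w (i + l.length), by simp, i, fun j hj => ?_⟩
    rcases Nat.lt_or_ge j l.length with h | h
    · rw [List.getElem_append_left h, hi j h]
    · obtain rfl : j = l.length := by simp at hj; omega
      simp
  choose! c hc using hext
  rw [factorComplexity_eq, factorComplexity_eq]
  -- Every word `l` extends by `c l`; a right special one also extends by the other letter `c l +
  -- 1`. The two families of extensions are disjoint.
  calc (wordsOfLength w n).ncard + R.card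
      = ((fun l => l ++ [c l]) '' wordsOfLength w n).ncard +
        ((fun l => l ++ [c l + 1]) '' (R : Set (List (Fin 2)))).ncard := by
        rw [Set.ncard_image_of_injective, Set.ncard_image_of_injective, Set.ncard_coe_finset]
        · intro l m h; exact (List.append_inj' h rfl).1
        · intro l m h; exact (List.append_inj' h rfl).1
    _ = (((fun l => l ++ [c l]) '' wordsOfLength w n) ∪
        ((fun l => l ++ [c l + 1]) '' (R : Set (List (Fin 2))))).ncard := by
        refine (Set.ncard_union_eq ?_ ((finite_wordsOfLength w n).image _)
          (R.finite_toSet.image _)).symm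
        rw [Set.disjoint_left]
        rintro _ ⟨l, hl, rfl⟩ ⟨m, hm, h⟩
        obtain ⟨rfl, h2⟩ := List.append_inj' h rfl
        simp at h2
    _ ≤ _ := by
        refine Set.ncard_le_ncard ?_ (finite_wordsOfLength w _)
        rintro _ (⟨l, hl, rfl⟩ | ⟨l, hl, rfl⟩)
        · exact hc l hl
        · obtain ⟨h1, h2⟩ := hR l hl
          exact ⟨by simp [h1], h2 _⟩

open WordMorphism

/-! ### The morphisms `γ`, `E` and their compositions -/

@[simp] theorem onList_gamma_zero : morphGamma.onList [0] = [0, 0, 1] := rfl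
@[simp] theorem onList_gamma_one : morphGamma.onList [1] = [1] := rfl
@[simp] theorem onList_E_zero : morphE.onList [0] = [1] := rfl
@[simp] theorem onList_E_one : morphE.onList [1] = [0] := rfl

theorem nonErasing_gamma : morphGamma.NonErasing := by
  intro a; fin_cases a <;> simp

theorem nonErasing_E : morphE.NonErasing := by
  intro a; fin_cases a <;> simp

@[simp] theorem morphE_mul_self : morphE * morphE = 1 := by
  refine ext_onList fun a => ?_
  fin_cases a <;> simp [onList_mul]

@[simp] theorem onList_gamma_pow_one (k : ℕ) : (morphGamma ^ k).onList [1] = [1] := by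
  induction k with
  | zero => simp
  | succ k ih => rw [pow_succ, onList_mul, onList_gamma_one, ih]

theorem onList_gamma_pow_succ_zero (k : ℕ) : (morphGamma ^ (k + 1)).onList [0] =
    (morphGamma ^ k).onList [0] ++ (morphGamma ^ k).onList [0] ++ [1] := by
  rw [pow_succ, onList_mul, onList_gamma_zero, onList_cons, onList_cons _ 0 [1],
    onList_gamma_pow_one, List.append_assoc]

theorem zero_prefix_gamma_pow (k : ℕ) : [0] <+: (morphGamma ^ k).onList [0] := by
  induction k with
  | zero => simp
  | succ k ih =>
    rw [onList_gamma_pow_succ_zero, List.append_assoc]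
    exact ih.trans (List.prefix_append _ _)

theorem zero_zero_prefix_gamma_pow (k : ℕ) : [0, 0] <+: (morphGamma ^ (k + 1)).onList [0] := by
  rw [pow_succ', onList_mul]
  refine List.IsPrefix.trans ⟨[1], ?_⟩ (onList_prefix _ (zero_prefix_gamma_pow k))
  simp

theorem gamma_pow_prefix {k n : ℕ} (h : k ≤ n) :
    (morphGamma ^ k).onList [0] <+: (morphGamma ^ n).onList [0] := by
  induction n, h using Nat.le_induction with
  | base => exact List.prefix_rfl
  | succ n _ ih =>
    rw [onList_gamma_pow_succ_zero, List.append_assoc]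
    exact ih.trans (List.prefix_append _ _)

/-- In `γᵏ⁺¹(0) = γᵏ(0) γᵏ(0) 1` the first copy of `γᵏ(0)` is followed by `0` and the second by `1`.
This is the source of the right special words. -/
theorem gamma_pow_append_prefix {k n : ℕ} (h : k < n) (a : Fin 2) :
    ∃ s, s ++ ((morphGamma ^ k).onList [0] ++ [a]) <+: (morphGamma ^ n).onList [0] := by
  have hp := gamma_pow_prefix (Nat.succ_le_of_lt h)
  rw [Nat.succ_eq_add_one, onList_gamma_pow_succ_zero] at hp
  fin_cases a
  · refine ⟨[], List.IsPrefix.trans ?_ hp⟩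
    rw [List.nil_append, List.append_assoc, List.prefix_append_right_inj]
    exact (zero_prefix_gamma_pow k).trans (List.prefix_append _ _)
  · exact ⟨_, by simpa using hp⟩

theorem exists_gamma_pow_eq (k : ℕ) :
    ∃ s, (morphGamma ^ k).onList [0] = s ++ 0 :: List.replicate k 1 := by
  induction k with
  | zero => exact ⟨[], by simp⟩
  | succ k ih =>
    obtain ⟨s, hs⟩ := ih
    refine ⟨(morphGamma ^ k).onList [0] ++ s, ?_⟩
    rw [onList_gamma_pow_succ_zero, hs, List.replicate_succ']
    simp

theorem nonErasing_gammaEComp (n : ℕ) : (gammaEComp n).NonErasing := by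
  induction n with
  | zero => exact nonErasing_gamma
  | succ n ih => exact (ih.mul nonErasing_E).mul (nonErasing_gamma.pow _)

theorem onList_gammaEComp_succ (n : ℕ) (l : List (Fin 2)) : (gammaEComp (n + 1)).onList l =
    (gammaEComp n).onList (morphE.onList ((morphGamma ^ (n + 2)).onList l)) := rfl

@[simp] theorem onList_gammaEComp_succ_one (n : ℕ) :
    (gammaEComp (n + 1)).onList [1] = (gammaEComp n).onList [0] := by
  simp [onList_gammaEComp_succ]

/-- The prefix `00` of `γⁿ⁺³(0)` becomes `11` under `E`, and `gammaEComp (n + 1)` maps `1` to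
`gammaEComp n (0)`. The shift by two is why the limit depends on parity. -/
theorem gammaEComp_prefix_add_two (n : ℕ) :
    (gammaEComp n).onList [0, 0] <+: (gammaEComp (n + 2)).onList [0] := by
  rw [onList_gammaEComp_succ]
  refine List.IsPrefix.trans ?_ (onList_prefix _ (onList_prefix _ (zero_zero_prefix_gamma_pow _)))
  rw [onList_cons morphE, onList_E_zero, onList_append, onList_gammaEComp_succ_one, ← onList_append]
  exact List.prefix_rfl

/-- For `a = 0`: `γⁿ⁺²(0)` ends with `1`, which `E` turns into `0`. -/
theorem gammaEComp_infix_succ (n : ℕ) (a : Fin 2) :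
    (gammaEComp n).onList [0] <:+: (gammaEComp (n + 1)).onList [a] := by
  fin_cases a
  · change _ <:+: (gammaEComp (n + 1)).onList [0]
    rw [onList_gammaEComp_succ, onList_gamma_pow_succ_zero]
    simp only [onList_append, onList_E_one]
    exact List.suffix_append _ _ |>.isInfix
  · change _ <:+: (gammaEComp (n + 1)).onList [1]
    rw [onList_gammaEComp_succ_one]

/-- `|γᵏ(0)|` has `2ᵏ - 1` letters `1`. -/
theorem length_onList_gamma_pow_ge (φ : WordMorphism (Fin 2)) (k : ℕ) :
    2 ^ k * (φ.onList [1]).length ≤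
      (φ.onList ((morphGamma ^ k).onList [0])).length + (φ.onList [1]).length := by
  induction k with
  | zero => simp
  | succ k ih =>
    rw [onList_gamma_pow_succ_zero]
    simp only [onList_append, List.length_append]
    rw [pow_succ, mul_assoc, mul_comm 2, ← mul_assoc]
    omega

/-- Each of the `2ⁿ⁺² - 1 ≥ n + 3` letters `1` of `γⁿ⁺²(0)` contributes one copy of `gammaEComp n
(0)`. -/
theorem length_gammaEComp_succ_ge (n : ℕ) :
    (n + 3) * ((gammaEComp n).onList [0]).length ≤ ((gammaEComp (n + 1)).onList [0]).length := by
  have h := length_onList_gamma_pow_ge (gammaEComp n * morphE) (n + 2)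
  rw [← onList_mul, onList_mul _ morphE, onList_E_one] at h
  change _ ≤ ((gammaEComp (n + 1)).onList [0]).length + _ at h
  have h2 : n + 4 ≤ 2 ^ (n + 2) := by
    have := n.lt_two_pow_self
    rw [pow_add]
    omega
  have h3 := (Nat.mul_le_mul_right ((gammaEComp n).onList [0]).length h2).trans h
  have h4 : (n + 4) * ((gammaEComp n).onList [0]).length =
    (n + 3) * ((gammaEComp n).onList [0]).length + ((gammaEComp n).onList [0]).length := by ring
  omega

theorem lt_length_gammaEComp (n : ℕ) : n < ((gammaEComp n).onList [0]).length := by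
  induction n with
  | zero => simp [gammaEComp]
  | succ n ih =>
    have := length_gammaEComp_succ_ge n
    nlinarith

/-! ### Fixed points -/

/-- The weight `f` is an eigenvector of the incidence matrix for the eigenvalue `2`, so the weight
of `σᵐ(a)` is exactly `2ᵐ f(a)`; weight and length differ by a factor of at most `2`. -/
theorem length_iterate_bounds {σ : WordMorphism (Fin 2)} {f : Fin 2 → ℕ}
    (hf : ∀ a, 1 ≤ f a ∧ f a ≤ 2) (hσ : ∀ a, ((σ.onList [a]).map f).sum = 2 * f a)
    (m : ℕ) (a : Fin 2) :
    2 ^ m ≤ 2 * ((σ ^ m).onList [a]).length ∧ ((σ ^ m).onList [a]).length ≤ 2 * 2 ^ m := by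
  have hlen : ∀ l : List (Fin 2), l.length ≤ (l.map f).sum ∧ (l.map f).sum ≤ 2 * l.length := by
    intro l
    induction l with
    | nil => simp
    | cons a l ih => have := hf a; simp only [List.map_cons, List.sum_cons, List.length_cons]; omega
  have hmul : ∀ l : List (Fin 2), ((σ.onList l).map f).sum = 2 * (l.map f).sum := by
    intro l
    induction l with
    | nil => simp
    | cons a l ih =>
      rw [onList_cons, List.map_append, List.sum_append, hσ, ih, List.map_cons, List.sum_cons]
      ring
  have hpow : (((σ ^ m).onList [a]).map f).sum = 2 ^ m * f a := by
    induction m with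
    | zero => simp
    | succ m ih => rw [pow_succ', onList_mul, hmul, ih]; ring
  have h1 := hlen ((σ ^ m).onList [a])
  have h2 := hf a
  rw [hpow] at h1
  constructor <;> nlinarith [Nat.two_pow_pos m]

theorem hasSubLinearComplexity_of_fixed {σ : WordMorphism (Fin 2)} {f : Fin 2 → ℕ}
    (hne : σ.NonErasing)
    (hf : ∀ a, 1 ≤ f a ∧ f a ≤ 2) (hσ : ∀ a, ((σ.onList [a]).map f).sum = 2 * f a)
    {k : ℕ} (hk : 1 ≤ k) {x : ℕ → Fin 2} (hx : (σ ^ k).onSeq x = x) :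
    HasSubLinearComplexity x := by
  have hocc : ∀ (n : ℕ) (l : List (Fin 2)), OccursAt l x 0 →
      OccursAt ((σ ^ (k * n)).onList l) x 0 := by
    intro n
    induction n with
    | zero => intro l hl; simpa using hl
    | succ n ih =>
      intro l hl
      rw [mul_add, mul_one, pow_add, onList_mul]
      refine ih _ ?_
      have := (hne.pow k).occursAt_onSeq hl
      rwa [hx] at this
  have hbound : ∀ N : ℕ, 1 ≤ N → factorComplexity x N ≤ 4 * (4 * 2 ^ k) * N := by
    intro N hN
    have hex : ∃ n, 2 * N ≤ 2 ^ (k * n) := by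
      refine ⟨2 * N, (Nat.lt_two_pow_self).le.trans (Nat.pow_le_pow_right (by norm_num) ?_)⟩
      exact Nat.le_mul_of_pos_left _ hk
    classical
    -- The least such `n` makes the blocks `σᵏⁿ(a)` long enough to have `N` letters, while
    -- minimality bounds their length by `4 · 2ᵏ · N`.
    obtain ⟨n, hn, hmin⟩ : ∃ n, 2 * N ≤ 2 ^ (k * n) ∧ ∀ m < n, ¬ 2 * N ≤ 2 ^ (k * m) :=
      ⟨Nat.find hex, Nat.find_spec hex, fun m hm => Nat.find_min hex hm⟩
    cases n with
    | zero => simp at hn; omega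
    | succ n =>
      have h1 := hmin n (by omega)
      have h2 := length_iterate_bounds hf hσ (k * (n + 1))
      refine (factorComplexity_le_of_cover (τ := σ ^ (k * (n + 1))) (N := N)
        (L := 4 * 2 ^ k * N) ?_ ?_ ?_).trans (le_of_eq ?_)
      · intro a; have := (h2 a).1; omega
      · intro a
        refine (h2 a).2.trans ?_
        rw [mul_add, mul_one, pow_add]
        nlinarith [Nat.two_pow_pos k]
      · intro m
        refine ⟨(List.range m).map x, ?_, hocc _ _ (occursAt_map_range x m)⟩
        simpa using (hne.pow (k * (n + 1))).length_le ((List.range m).map x)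
      · simp; ring
  refine IsBigO.of_bound ((4 * (4 * 2 ^ k) : ℕ) : ℝ) ?_
  filter_upwards [eventually_ge_atTop 1] with N hN
  rw [Real.norm_natCast, Real.norm_natCast]
  exact_mod_cast hbound N hN

theorem hasSubLinearComplexity_of_mem {σ : WordMorphism (Fin 2)}
    (h : σ ∈ ({morphGamma * morphE, morphE * morphGamma} : Set (WordMorphism (Fin 2))))
    {k : ℕ} (hk : 1 ≤ k) {x : ℕ → Fin 2} (hx : (σ ^ k).onSeq x = x) :
    HasSubLinearComplexity x := by
  rcases h with rfl | rfl
  · refine hasSubLinearComplexity_of_fixed (f := ![1, 2])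
      (nonErasing_gamma.mul nonErasing_E) ?_ ?_ hk hx
    · decide
    · intro a; fin_cases a <;> rfl
  · refine hasSubLinearComplexity_of_fixed (f := ![2, 1])
      (nonErasing_E.mul nonErasing_gamma) ?_ ?_ hk hx
    · decide
    · intro a; fin_cases a <;> rfl

/-! ### Images of distinct letters -/

/-- The images of distinct letters begin with distinct letters. -/
def HasDistinctHeads (φ : WordMorphism (Fin 2)) : Prop :=
  ∃ c : Fin 2 → Fin 2, Function.Injective c ∧ ∀ a, [c a] <+: φ.onList [a]

theorem HasDistinctHeads.mul {φ ψ : WordMorphism (Fin 2)} (hφ : HasDistinctHeads φ)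
    (hψ : HasDistinctHeads ψ) : HasDistinctHeads (φ * ψ) := by
  obtain ⟨c, hc, h⟩ := hφ
  obtain ⟨d, hd, h'⟩ := hψ
  exact ⟨c ∘ d, hc.comp hd, fun a => (h (d a)).trans (onList_prefix φ (h' a))⟩

theorem hasDistinctHeads_gamma : HasDistinctHeads morphGamma := by
  refine ⟨id, Function.injective_id, fun a => ?_⟩
  fin_cases a <;> simp

theorem hasDistinctHeads_E : HasDistinctHeads morphE := by
  refine ⟨fun a => a + 1, add_left_injective 1, fun a => ?_⟩
  fin_cases a <;> simp

theorem hasDistinctHeads_gamma_pow (k : ℕ) : HasDistinctHeads (morphGamma ^ k) := by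
  induction k with
  | zero => exact ⟨id, Function.injective_id, fun a => by simp⟩
  | succ k ih => rw [pow_succ]; exact ih.mul hasDistinctHeads_gamma

theorem hasDistinctHeads_gammaEComp (n : ℕ) : HasDistinctHeads (gammaEComp n) := by
  induction n with
  | zero => exact hasDistinctHeads_gamma
  | succ n ih => exact (ih.mul hasDistinctHeads_E).mul (hasDistinctHeads_gamma_pow _)

/-- `φ` is conjugate, by the word `t`, to a morphism for which the images of distinct letters
end with distinct letters. Thus `t` is the longest common suffix of all the `t φ(v)`. -/
def IsTailConj (φ : WordMorphism (Fin 2)) (t : List (Fin 2)) : Prop :=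
  ∃ ψ : WordMorphism (Fin 2), (∀ v, t ++ φ.onList v = ψ.onList v ++ t) ∧
    ∃ c : Fin 2 → Fin 2, Function.Injective c ∧ ∀ a, [c a] <:+ ψ.onList [a]

/-- `t φ(t') φ(φ'(v)) = t φ(ψ'(v) t') = ψ(ψ'(v)) t φ(t')`. -/
theorem IsTailConj.mul {φ φ' : WordMorphism (Fin 2)} {t t' : List (Fin 2)} (h : IsTailConj φ t)
    (h' : IsTailConj φ' t') : IsTailConj (φ * φ') (t ++ φ.onList t') := by
  obtain ⟨ψ, hψ, c, hc, hcs⟩ := h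
  obtain ⟨ψ', hψ', c', hc', hcs'⟩ := h'
  refine ⟨ψ * ψ', fun v => ?_, c ∘ c', hc.comp hc', fun a => ?_⟩
  · rw [onList_mul, onList_mul, List.append_assoc, ← onList_append, hψ', onList_append, hψ t',
      ← List.append_assoc, hψ, List.append_assoc, hψ]
  · obtain ⟨s, hs⟩ := hcs' a
    rw [onList_mul, ← hs, onList_append]
    exact (hcs (c' a)).trans (List.suffix_append _ _)

/-- The morphism `[100, 1]`, conjugate to `γ`. -/
def morphGammaConj : WordMorphism (Fin 2) :=
  FreeMonoid.lift ![FreeMonoid.ofList [1, 0, 0], FreeMonoid.ofList [1]]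

theorem isTailConj_gamma : IsTailConj morphGamma [1] := by
  refine ⟨morphGammaConj, fun v => ?_, id, Function.injective_id, fun a => ?_⟩
  · induction v with
    | nil => simp
    | cons a v ih =>
      rw [onList_cons, onList_cons morphGammaConj, List.append_assoc, ← ih]
      fin_cases a <;> rfl
  · fin_cases a
    · exact ⟨[1, 0], rfl⟩
    · exact ⟨[], rfl⟩

theorem isTailConj_gamma_pow (k : ℕ) : IsTailConj (morphGamma ^ k) (List.replicate k 1) := by
  induction k with
  | zero => exact ⟨1, fun v => by simp, id, Function.injective_id, fun a => by simp⟩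
  | succ k ih =>
    rw [pow_succ, List.replicate_succ', ← onList_gamma_pow_one k]
    exact ih.mul isTailConj_gamma

theorem isTailConj_E : IsTailConj morphE [] := by
  refine ⟨morphE, fun v => by simp, fun a => a + 1, add_left_injective 1, fun a => ?_⟩
  fin_cases a <;> simp

theorem length_onList_replicate (φ : WordMorphism (Fin 2)) (k : ℕ) (a : Fin 2) :
    (φ.onList (List.replicate k a)).length = k * (φ.onList [a]).length := by
  induction k with
  | zero => simp
  | succ k ih => rw [List.replicate_succ', onList_append, List.length_append, ih]; ring

/-- By composition the conjugating word at level `n + 1` is the one at level `n` followed by `n + 2`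
copies of `gammaEComp n (0)`. Inductively it has length at most `(n + 3) ℓ`, which
`length_gammaEComp_succ_ge` absorbs. -/
theorem exists_isTailConj_gammaEComp (n : ℕ) : ∃ t, IsTailConj (gammaEComp n * morphE) t ∧
    t.length ≤ ((gammaEComp n).onList [0]).length := by
  suffices ∃ t, IsTailConj (gammaEComp n) t ∧
      t.length ≤ ((gammaEComp n).onList [0]).length by
    obtain ⟨t, ht, hlen⟩ := this
    exact ⟨t, by simpa using ht.mul isTailConj_E, hlen⟩
  induction n with
  | zero => exact ⟨[1], isTailConj_gamma, by simp [gammaEComp]⟩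
  | succ n ih =>
    obtain ⟨t, ht, hlen⟩ := ih
    refine ⟨_, (ht.mul isTailConj_E).mul (isTailConj_gamma_pow (n + 2)), ?_⟩
    refine le_trans ?_ (length_gammaEComp_succ_ge n)
    rw [List.length_append, length_onList_replicate, onList_mul, onList_E_one]
    simp only [onList_nil, List.append_nil]
    linarith

/-- Long common suffixes of `φ(v a z)` and `φ(v' b z)` force `a = b`. -/
theorem IsTailConj.eq_of_suffix {φ : WordMorphism (Fin 2)} {t : List (Fin 2)}
    (h : IsTailConj φ t) {s v v' z : List (Fin 2)} {a b : Fin 2}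
    (hs : s <:+ φ.onList (v ++ a :: z)) (hs' : s <:+ φ.onList (v' ++ b :: z))
    (hlen : t.length + (φ.onList z).length < s.length) : a = b := by
  obtain ⟨ψ, hψ, c, hc, hcs⟩ := h
  -- `t φ(v a z) = ψ(v) ψ(a) t φ(z)`, and `ψ(a)` ends with `c a`; so the letter of `s` just before
  -- its suffix `t φ(z)` reveals `a`.
  have key : ∀ (v : List (Fin 2)) (a : Fin 2), s <:+ φ.onList (v ++ a :: z) →
      c a :: (t ++ φ.onList z) <:+ s := by
    intro v a hs
    obtain ⟨r, hr⟩ := hcs a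
    refine List.suffix_of_suffix_length_le ?_ (hs.trans (List.suffix_append t _)) (by simp; omega)
    refine ⟨ψ.onList v ++ r, ?_⟩
    rw [show v ++ a :: z = (v ++ [a]) ++ z by simp, onList_append, ← List.append_assoc, hψ (v ++ [a]),
      onList_append, ← hr]
    simp
  have h1 := List.suffix_of_suffix_length_le (key v a hs) (key v' b hs') (by simp)
  have h2 := h1.eq_of_length (by simp)
  exact hc (List.cons.inj h2).1

/-! ### Complexity -/

/-- For `K ≤ k < n + 2`, the suffixes of length `N` of `φ(γᵏ(0))` are distinct right special words.
The upper bound on `N` makes these suffixes exist, the lower bound makes them distinct. -/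
theorem factorComplexity_add_le {w : ℕ → Fin 2} {n K N : ℕ}
    (hw : ∃ i, OccursAt ((gammaEComp (n + 1)).onList [0]) w i)
    (hN : (n + 3) * ((gammaEComp n).onList [0]).length ≤ N)
    (hN' : N + ((gammaEComp n).onList [0]).length ≤ 2 ^ K * ((gammaEComp n).onList [0]).length) :
    factorComplexity w N + (n + 2 - K) ≤ factorComplexity w (N + 1) := by
  classical
  obtain ⟨i₀, hw⟩ := hw
  obtain ⟨t, ht, htlen⟩ := exists_isTailConj_gammaEComp n
  obtain ⟨c, hc, hch⟩ := (hasDistinctHeads_gammaEComp n).mul hasDistinctHeads_E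
  set φ := gammaEComp n * morphE with hφ
  set ℓ := ((gammaEComp n).onList [0]).length with hℓ
  have hpos : 0 < ℓ := (Nat.zero_le n).trans_lt (lt_length_gammaEComp n)
  have hφ1 : (φ.onList [1]).length = ℓ := by rw [hφ, onList_mul, onList_E_one]
  let g : ℕ → List (Fin 2) := fun k => φ.onList ((morphGamma ^ k).onList [0])
  have hg : ∀ k, K ≤ k → N ≤ (g k).length := by
    intro k hk
    have h1 := length_onList_gamma_pow_ge φ k
    have h2 : 2 ^ K * ℓ ≤ 2 ^ k * ℓ :=
      Nat.mul_le_mul_right _ (Nat.pow_le_pow_right (by norm_num) hk)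
    rw [hφ1] at h1
    change 2 ^ k * ℓ ≤ (g k).length + ℓ at h1
    omega
  let r : ℕ → List (Fin 2) := fun k => (g k).drop ((g k).length - N)
  have hr : ∀ k, r k <:+ g k := fun k => List.drop_suffix _ _
  have hrlen : ∀ k, K ≤ k → (r k).length = N := by
    intro k hk
    have := hg k hk
    simp only [r, List.length_drop]
    omega
  -- For `k < m`, reading from the right, `γᵏ(0)` has a `0` after `1ᵏ` where `γᵐ(0)` has a further
  -- `1`. Equal suffixes would agree on `N > ℓ + k ℓ` letters, forcing `0 = 1`.
  have hlt : ∀ k m, K ≤ k → k < m → m < n + 2 → r k ≠ r m := by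
    intro k m hk hkm hm heq
    obtain ⟨s, hs⟩ := exists_gamma_pow_eq k
    obtain ⟨s', hs'⟩ := exists_gamma_pow_eq m
    have h1 : r k <:+ φ.onList (s ++ 0 :: List.replicate k 1) := hs ▸ hr k
    have h2 : r k <:+
        φ.onList ((s' ++ 0 :: List.replicate (m - k - 1) 1) ++ 1 :: List.replicate k 1) := by
      have e : (s' ++ 0 :: List.replicate (m - k - 1) 1) ++ 1 :: List.replicate k (1 : Fin 2) =
          s' ++ 0 :: List.replicate m 1 := by
        rw [← List.replicate_succ, List.append_assoc, List.cons_append, List.replicate_append_replicate]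
        congr 3; omega
      rw [heq, e, ← hs']
      exact hr m
    refine zero_ne_one (ht.eq_of_suffix h1 h2 ?_)
    rw [length_onList_replicate, hφ1, hrlen k hk]
    have : (k + 1) * ℓ < (n + 3) * ℓ := Nat.mul_lt_mul_of_pos_right (by omega) hpos
    linarith
  have hinj : Set.InjOn r (Finset.Ico K (n + 2)) := by
    intro k hk m hm h
    simp only [Finset.coe_Ico, Set.mem_Ico] at hk hm
    rcases lt_trichotomy k m with hkm | hkm | hkm
    · exact (hlt k m hk.1 hkm hm.2 h).elim
    · exact hkm
    · exact (hlt m k hm.1 hkm hk.2 h.symm).elim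
  have hcard : ((Finset.Ico K (n + 2)).image r).card = n + 2 - K := by
    rw [Finset.card_image_of_injOn hinj, Nat.card_Ico]
  rw [← hcard]
  refine factorComplexity_add_card_le _ fun l hl => ?_
  obtain ⟨k, hk, rfl⟩ := Finset.mem_image.1 hl
  rw [Finset.mem_Ico] at hk
  refine ⟨hrlen k hk.1, fun a => ?_⟩
  -- Any letter `a` is the head `c b` of some `φ(b)`, and `γᵏ(0) b` occurs in `γⁿ⁺²(0)`.
  obtain ⟨b, rfl⟩ := (Finite.injective_iff_surjective.1 hc) a
  obtain ⟨s, hs⟩ := gamma_pow_append_prefix hk.2 b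
  obtain ⟨q, hq⟩ := hr k
  have hocc : OccursAt (φ.onList ((morphGamma ^ (n + 2)).onList [0])) w i₀ := hw
  have hpre : φ.onList s ++ q ++ (r k ++ [c b]) <+:
      φ.onList ((morphGamma ^ (n + 2)).onList [0]) := by
    refine List.IsPrefix.trans ?_ (onList_prefix φ hs)
    rw [onList_append, onList_append, List.append_assoc, List.prefix_append_right_inj,
      ← List.append_assoc, hq, List.prefix_append_right_inj]
    exact hch b
  have := hocc.of_prefix hpre
  exact ⟨_, OccursAt.of_append (l₁ := φ.onList s ++ q) (l₃ := []) (by simpa using this)⟩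

/-- The level `e K` is taken near `2K` so that at least `K` right special words remain; the freedom
of one unit accommodates both parities. -/
theorem not_hasSubLinearComplexity {w : ℕ → Fin 2} {e : ℕ → ℕ}
    (he : ∀ K, 2 * K ≤ e K ∧ e K ≤ 2 * K + 1)
    (hw : ∀ K, ∃ i, OccursAt ((gammaEComp (e K + 1)).onList [0]) w i) :
    ¬ HasSubLinearComplexity w := by
  intro h
  obtain ⟨C, hC⟩ := h.bound
  obtain ⟨N₀, hN₀⟩ := eventually_atTop.1 hC
  obtain ⟨B, hB⟩ := exists_nat_gt C
  obtain ⟨K, hK1, hK2, hK3⟩ : ∃ K : ℕ, 6 ≤ K ∧ 2 * B ≤ K ∧ N₀ ≤ K :=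
    ⟨6 + 2 * B + N₀, by omega, by omega, by omega⟩
  obtain ⟨he1, he2⟩ := he K
  have hadd := fun N => factorComplexity_add_le (hw K) (K := K) (N := N)
  have hpos := (Nat.zero_le _).trans_lt (lt_length_gammaEComp (e K))
  generalize ((gammaEComp (e K)).onList [0]).length = ℓ at hadd hpos
  generalize e K = n at hadd he1 he2
  -- As `n ≤ 2K + 1`, this gives `2(n + 3) + 1 ≤ 2ᴷ`, so every length from `(n + 3) ℓ` to twice that
  -- is admissible.
  have hpow : 4 * K + 9 ≤ 2 ^ K := by
    clear * - hK1
    induction K, hK1 using Nat.le_induction with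
    | base => norm_num
    | succ K hK ih => rw [pow_succ]; omega
  have hstep : ∀ j, j ≤ (n + 3) * ℓ →
      j * K ≤ factorComplexity w ((n + 3) * ℓ + j) := by
    intro j
    induction j with
    | zero => simp
    | succ j ih =>
      intro hj
      have h1 := ih (by omega)
      have h2 := hadd ((n + 3) * ℓ + j) (by omega) ?_
      · rw [← add_assoc, add_mul, one_mul]
        omega
      · have h3 : (4 * K + 9) * ℓ ≤ 2 ^ K * ℓ := Nat.mul_le_mul_right _ hpow
        have h4 : (2 * (n + 3) + 1) * ℓ ≤ (4 * K + 9) * ℓ := Nat.mul_le_mul_right _ (by omega)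
        have h5 : (2 * (n + 3) + 1) * ℓ = (n + 3) * ℓ + (n + 3) * ℓ + ℓ := by ring
        omega
  have hfin := hstep _ le_rfl
  set M := (n + 3) * ℓ with hM
  have hMK : n + 3 ≤ M := Nat.le_mul_of_pos_right _ hpos
  have hb := hN₀ (M + M) (by omega)
  rw [Real.norm_natCast, Real.norm_natCast] at hb
  have h1 : ((M * K : ℕ) : ℝ) ≤ C * ((M + M : ℕ) : ℝ) := (Nat.cast_le.2 hfin).trans hb
  have h2 : C * ((M + M : ℕ) : ℝ) < (B : ℝ) * ((M + M : ℕ) : ℝ) :=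
    mul_lt_mul_of_pos_right hB (by exact_mod_cast (by omega : 0 < M + M))
  have h3 : M * K < B * (M + M) := by exact_mod_cast h1.trans_lt h2
  nlinarith

/-! ### The limits -/

theorem gammaEComp_prefix_limits (r m : ℕ) :
    (gammaEComp (2 * m + r)).onList [0, 0] <+: (gammaEComp (2 * (m + 1) + r)).onList [0] := by
  rw [show 2 * (m + 1) + r = 2 * m + r + 2 by ring]
  exact gammaEComp_prefix_add_two _

theorem gammaEComp_zero_prefix (n : ℕ) :
    (gammaEComp n).onList [0] <+: (gammaEComp n).onList [0, 0] :=
  onList_prefix _ ⟨[0], rfl⟩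

theorem exists_limit (r : ℕ) :
    ∃ w : ℕ → Fin 2, ∀ m, OccursAt ((gammaEComp (2 * m + r)).onList [0]) w 0 := by
  refine exists_seq_of_prefix_chain _ (fun m => ?_) fun m => ?_
  · exact (gammaEComp_zero_prefix _).trans (gammaEComp_prefix_limits r m)
  · exact (by omega : m ≤ 2 * m + r).trans_lt (lt_length_gammaEComp _)

theorem exists_gammaEComp_add_eq (a b : ℕ) (v : List (Fin 2)) :
    ∃ v', (gammaEComp (a + b)).onList v = (gammaEComp a).onList v' := by
  induction b generalizing v with
  | zero => exact ⟨v, rfl⟩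
  | succ b ih => exact ih _

section Limit

variable {r : ℕ} {w : ℕ → Fin 2}

theorem tendsto_limit (hw : ∀ m, OccursAt ((gammaEComp (2 * m + r)).onList [0]) w 0) :
    Tendsto (fun m : ℕ => (gammaEComp (2 * m + r)).onSeq (fun _ => 0)) atTop (𝓝 w) := by
  refine tendsto_of_occursAt (fun m => (nonErasing_gammaEComp _).occursAt_onSeq (l := [0]) ?_) hw
    (tendsto_atTop_mono (fun m => ?_) tendsto_id)
  · intro j hj
    obtain rfl : j = 0 := by simpa using hj
    rfl
  · exact (by simp; omega : id m ≤ 2 * m + r).trans (lt_length_gammaEComp _).le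

theorem isUniformlyRecurrent_limit
    (hw : ∀ m, OccursAt ((gammaEComp (2 * m + r)).onList [0]) w 0) : IsUniformlyRecurrent w := by
  rintro n u ⟨i, hi⟩
  have hmem : OccursAt (List.ofFn u) w i := fun j hj => by
    simpa using hi ⟨j, by simpa using hj⟩
  have hlt := lt_length_gammaEComp (2 * (i + n) + r)
  have hinf : List.ofFn u <:+: (gammaEComp (2 * (i + n) + r)).onList [0] := by
    have hl := hw (i + n)
    generalize (gammaEComp (2 * (i + n) + r)).onList [0] = l at hl hlt
    have e : List.ofFn u = (l.drop i).take n := by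
      refine List.ext_getElem (by simp; omega) fun j hj hj' => ?_
      rw [List.getElem_take, List.getElem_drop, hl _ (by simp only [List.length_ofFn] at hj; omega), hmem j hj, zero_add]
    rw [e]
    exact (List.take_prefix _ _).isInfix.trans (List.drop_suffix _ _).isInfix
  obtain ⟨g, hg⟩ := exists_gap (w := w) (fun a => hinf.trans (gammaEComp_infix_succ _ a))
    fun N => by
      -- The odd increment restores the parity of `r`, so that the image of `v` is one of the given
      -- prefixes of `w`.
      obtain ⟨v, hv⟩ := exists_gammaEComp_add_eq (2 * (i + n) + r + 1) (2 * N + 1) [0]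
      rw [show 2 * (i + n) + r + 1 + (2 * N + 1) = 2 * (i + n + N + 1) + r by ring] at hv
      refine ⟨v, hv ▸ ?_, hv ▸ hw _⟩
      exact (by omega : N ≤ 2 * (i + n + N + 1) + r).trans (lt_length_gammaEComp _).le
  refine ⟨g, fun m => ?_⟩
  obtain ⟨k, h1, h2, h3⟩ := hg m
  exact ⟨k, h1, h2, fun j => by simpa using h3 j (by simp)⟩

theorem not_hasSubLinearComplexity_limit (hr : r < 2)
    (hw : ∀ m, OccursAt ((gammaEComp (2 * m + r)).onList [0]) w 0) :
    ¬ HasSubLinearComplexity w := by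
  -- With this choice `e K + 1` has the parity of `r`.
  refine not_hasSubLinearComplexity (e := fun K => 2 * K + (1 - r)) (fun K => by omega)
    fun K => ?_
  rcases Nat.lt_succ_iff_lt_or_eq.1 hr with h | rfl
  · obtain rfl : r = 0 := by omega
    exact ⟨0, by simpa [mul_add] using hw (K + 1)⟩
  · exact ⟨0, by simpa using hw K⟩

end Limit

/-! ### The directive word -/

/-- The composition of the first `k` blocks `γ E`, `γ² E`, …, `γᵏ E`. -/
def blockComp : ℕ → WordMorphism (Fin 2)
  | 0 => 1
  | k + 1 => gammaEComp k * morphE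

theorem gammaEComp_eq_blockComp (k : ℕ) :
    gammaEComp k = blockComp k * morphGamma ^ (k + 1) := by
  cases k with
  | zero => simp [blockComp, gammaEComp]
  | succ k => rfl

theorem blockComp_succ (k : ℕ) :
    blockComp (k + 1) = blockComp k * morphGamma ^ (k + 1) * morphE := by
  rw [← gammaEComp_eq_blockComp, blockComp]

/-- The passage from one state of `directiveState` to the next one. -/
def directiveStep (s : ℕ × ℕ × Bool) : ℕ × ℕ × Bool :=
  if s.2.1 = s.1 then (s.1 + 1, 0, s.2.2) else (s.1, s.2.1 + 1, !s.2.2)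

/-- The position after `i + 1` occurrences of `γ` in `γ E γ² E γ³ ⋯`: `(k, j, b)` stands for `k`
complete blocks followed by `γʲ⁺¹`, and `b` tells whether the first `i + 1` terms of the directive
word also include the letter `E` that follows. -/
def directiveState : ℕ → ℕ × ℕ × Bool
  | 0 => (0, 0, true)
  | i + 1 => directiveStep (directiveState i)

/-- `E` if the flag is set. -/
def flagE (b : Bool) : WordMorphism (Fin 2) := if b then morphE else 1

/-- The directive word in `{γE, Eγ}` of `γ E γ² E γ³ ⋯`. -/
def directive (i : ℕ) : WordMorphism (Fin 2) :=
  if (directiveState i).2.2 then morphGamma * morphE else morphE * morphGamma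

/-- Inside a block the flag flips: a pending `E` is cancelled by `Eγ`, and otherwise `γE` creates
one. Between blocks an `E` is due: a pending one serves, followed by `γE`, or else `Eγ` supplies it,
so the flag persists. -/
theorem prefixComp_directive (i : ℕ) : prefixComp directive (i + 1) =
    blockComp (directiveState i).1 * morphGamma ^ ((directiveState i).2.1 + 1) *
      flagE (directiveState i).2.2 := by
  induction i with
  | zero => simp [prefixComp, directive, directiveState, blockComp, flagE]
  | succ i ih =>
    rw [prefixComp, ih, directive, directiveState]
    generalize directiveState i = s
    obtain ⟨k, j, b⟩ := s
    have hEE : ∀ τ : WordMorphism (Fin 2), morphE * (morphE * τ) = τ := fun τ => by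
      rw [← mul_assoc, morphE_mul_self, one_mul]
    by_cases h : j = k
    · subst h
      cases b <;>
        simp [directiveStep, flagE, blockComp_succ, mul_assoc]
    · cases b <;> simp [directiveStep, flagE, h, pow_succ, mul_assoc, hEE]

/-- Counts the `i + 1` letters `γ`: the `k` complete blocks contain `k(k + 1)/2` of them, and `j +
1` follow. -/
theorem directiveState_le (i : ℕ) : (directiveState i).2.1 ≤ (directiveState i).1 ∧
    2 * i = (directiveState i).1 * ((directiveState i).1 + 1) + 2 * (directiveState i).2.1 := by
  induction i with
  | zero => simp [directiveState]
  | succ i ih =>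
    rw [directiveState]
    generalize directiveState i = s at ih ⊢
    obtain ⟨k, j, b⟩ := s
    obtain ⟨h1, h2⟩ : j ≤ k ∧ 2 * i = k * (k + 1) + 2 * j := ih
    by_cases h : j = k
    · subst h
      refine ⟨by simp [directiveStep], ?_⟩
      simp only [directiveStep, if_true]
      linarith
    · refine ⟨by simp only [directiveStep, h, if_false]; omega, ?_⟩
      simp only [directiveStep, h, if_false]
      linarith

theorem tendsto_directiveState : Tendsto (fun i => (directiveState i).1) atTop atTop := by
  refine tendsto_atTop.2 fun K => ?_
  filter_upwards [eventually_ge_atTop ((K + 1) * (K + 1))] with i hi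
  by_contra! h
  obtain ⟨h1, h2⟩ := directiveState_le i
  nlinarith

/-- The letter of which the powers are taken after `k` blocks, up to an application of `E`. -/
def seedLetter (r k : ℕ) : Fin 2 := if k % 2 = r % 2 then 0 else 1

/-- If `k` has the parity of `r`, the seed `0` gives `γʲ⁺¹(0) = 00…`, whose image under `blockComp
k` begins with `gammaEComp (k - 2) (00)`. Otherwise the seed `1` is fixed by `γ` and has image
`gammaEComp (k - 1) (0)`. -/
theorem exists_prefix_blockComp (r k j : ℕ) (hk : r + 2 ≤ k) : ∃ m, k ≤ 2 * m + r + 2 ∧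
    (gammaEComp (2 * m + r)).onList [0] <+:
      (blockComp k * morphGamma ^ (j + 1)).onList [seedLetter r k] := by
  obtain ⟨k, rfl⟩ : ∃ k', k = k' + 2 := ⟨k - 2, by omega⟩
  have hb : blockComp (k + 2) = gammaEComp (k + 1) * morphE := rfl
  rw [seedLetter]
  split_ifs with h
  · obtain ⟨m, rfl⟩ : ∃ m, k = 2 * m + r := ⟨(k - r) / 2, by omega⟩
    refine ⟨m, by omega, (gammaEComp_zero_prefix _).trans ?_⟩
    rw [onList_mul]
    refine List.IsPrefix.trans ?_ (onList_prefix _ (zero_zero_prefix_gamma_pow _))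
    rw [hb, onList_mul, onList_cons morphE, onList_E_zero, onList_append,
      onList_gammaEComp_succ_one, ← onList_append]
    exact List.prefix_rfl
  · obtain ⟨m, hm⟩ : ∃ m, k + 1 = 2 * m + r := ⟨(k + 1 - r) / 2, by omega⟩
    refine ⟨m, by omega, ?_⟩
    rw [onList_mul, onList_gamma_pow_one, hb, onList_mul, onList_E_one, hm]

theorem directive_mem (i : ℕ) : directive i ∈
    ({morphGamma * morphE, morphE * morphGamma} : Set (WordMorphism (Fin 2))) := by
  rw [directive]
  split_ifs <;> simp

theorem nonErasing_prefixComp_directive (i : ℕ) : (prefixComp directive i).NonErasing := by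
  induction i with
  | zero => exact NonErasing.one
  | succ i ih =>
    refine ih.mul ?_
    rcases directive_mem i with h | h <;> rw [h]
    · exact nonErasing_gamma.mul nonErasing_E
    · exact nonErasing_E.mul nonErasing_gamma

theorem exists_flagE_eq (b : Bool) (c : Fin 2) : ∃ a, (flagE b).onList [a] = [c] := by
  cases b
  · exact ⟨c, by simp [flagE]⟩
  · refine ⟨c + 1, ?_⟩
    fin_cases c <;> simp [flagE]

theorem isSAdic_limit {r : ℕ} {w : ℕ → Fin 2}
    (hw : ∀ m, OccursAt ((gammaEComp (2 * m + r)).onList [0]) w 0) :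
    IsSAdic {morphGamma * morphE, morphE * morphGamma} w := by
  choose a ha using fun i =>
    exists_flagE_eq (directiveState i).2.2 (seedLetter r (directiveState i).1)
  have hl : ∀ i, ∃ l : List (Fin 2), (directiveState i).1 ≤ l.length + r + 2 ∧ OccursAt l w 0 ∧
      l <+: (prefixComp directive (i + 1)).onList [a i] := by
    intro i
    rcases Nat.lt_or_ge (directiveState i).1 (r + 2) with h | h
    · exact ⟨[], by simp; omega, fun j hj => by simp at hj, List.nil_prefix⟩
    · obtain ⟨m, h1, h2⟩ := exists_prefix_blockComp r _ (directiveState i).2.1 h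
      refine ⟨_, ?_, hw m, ?_⟩
      · have := lt_length_gammaEComp (2 * m + r)
        omega
      · rw [prefixComp_directive, onList_mul, ha]
        exact h2
  choose l hlen hocc hpre using hl
  have htend : Tendsto (fun i => (l i).length) atTop atTop := by
    have := tendsto_atTop_mono hlen tendsto_directiveState
    simp only [add_assoc] at this
    refine tendsto_atTop.2 fun N => ?_
    filter_upwards [tendsto_atTop.1 this (N + (r + 2))] with i hi
    omega
  -- The shift matches `IsSAdic`, where the letter of index `n + 1` goes with the product of the
  -- first `n + 1` morphisms.
  refine ⟨directive, fun n => a (n - 1), directive_mem, ?_, ?_⟩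
  · refine tendsto_of_occursAt (l := l) (fun i => ?_) hocc htend
    refine OccursAt.of_prefix ?_ (hpre i)
    refine (nonErasing_prefixComp_directive _).occursAt_onSeq fun j hj => ?_
    obtain rfl : j = 0 := by simpa using hj
    rfl
  · exact tendsto_atTop_mono (fun i => (hpre i).length_le) htend

theorem proposition3p9 :
    (∃ w : Fin 2 → ℕ → Fin 2, ∀ r : Fin 2,
      Tendsto (fun m : ℕ => (gammaEComp (2 * m + (r : ℕ))).onSeq (fun _ => 0)) atTop (𝓝 (w r)) ∧
      IsSAdic {morphGamma * morphE, morphE * morphGamma} (w r) ∧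
      IsUniformlyRecurrent (w r) ∧
      ¬ HasSubLinearComplexity (w r)) ∧
    (∀ σ ∈ ({morphGamma * morphE, morphE * morphGamma} : Set (WordMorphism (Fin 2))),
      ∀ k : ℕ, 1 ≤ k → ∀ x : ℕ → Fin 2, (σ ^ k).onSeq x = x → HasSubLinearComplexity x) := by
  choose w hw using fun r : Fin 2 => exists_limit (r : ℕ)
  exact ⟨⟨w, fun r => ⟨tendsto_limit (hw r), isSAdic_limit (hw r),
    isUniformlyRecurrent_limit (hw r), not_hasSubLinearComplexity_limit r.2 (hw r)⟩⟩,
    fun σ hσ k hk x hx => hasSubLinearComplexity_of_mem hσ hk hx⟩
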